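/- Let $r\le m$ and let $P$ be a (Hermitian) positive definite $m\times m$ complex matrix. Write $\bar X'$ for the conjugate transpose and $|\cdot|$ for the determinant. For an $m\times r$ complex matrix $Z$ of full column rank let $H_Z=Z(\bar Z'Z)^{-1/2}$ be its orientation, an element of the complex Stiefel manifold $V^{\mathbb C}_{r,m}=\{X\in\mathbb C^{m\times r}:\bar X'X=I_r\}$. Let $\mathrm{CMACG}(P)$ denote the law of $H_W$, where $W$ has the complex matrix-variate central normal distribution $mN^{\mathbb C}(0,I_r,P)$, i.e. the density $\pi^{-mr}|P|^{-r}\exp\{-\operatorname{tr}(\bar W'P^{-1}W)\}$ with respect to Lebesgue measure on $\mathbb C^{m\times r}\cong\mathbb R^{2mr}$. Let $Z$ be an $m\times r$ complex random matrix that has, with respect to Lebesgue measure, a density of the form $$f_Z(Z)=|P|^{-r}\,g(\bar Z'P^{-1}Z)$$ which is invariant under right unitary transformations: $f_Z(ZQ)=f_Z(Z)$ for all $Z\in\mathbb C^{m\times r}$ and all $r\times r$ matrices $Q$ with $\bar Q'Q=I_r$. Then, almost surely, $Z$ has rank $r$ and $H_Z\in V^{\mathbb C}_{r,m}$, and $H_Z$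 has the $\mathrm{CMACG}(P)$ distribution; that is, $H_Z$ has the same law as in the Gaussian case, and with respect to the normalized invariant measure (of total mass one) on $V^{\mathbb C}_{r,m}$ it has the density $$f_{H_Z}(H)=|P|^{-r}\,|\bar H'P^{-1}H|^{-m}.$$ -/

import Mathlib

open MeasureTheory ProbabilityTheory Matrix
open scoped ComplexOrder MatrixOrder

namespace CMACG

/-- The Borel sigma-algebra on complex matrices (product of the Borel sigma-algebras of the
entries). -/
noncomputable instance instMeasurableSpaceMatrix (m r : ℕ) :
    MeasurableSpace (Matrix (Fin m) (Fin r) ℂ) :=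
  MeasurableSpace.pi

instance instBorelSpaceMatrix (m r : ℕ) : BorelSpace (Matrix (Fin m) (Fin r) ℂ) :=
  Pi.borelSpace (X := fun _ : Fin m => Fin r → ℂ)

/-- The unitary group is compact: it is closed and its entries are bounded by one. -/
instance instCompactSpaceUnitary (m : ℕ) : CompactSpace (Matrix.unitaryGroup (Fin m) ℂ) := by
  refine isCompact_iff_compactSpace.mp ?_
  have hK : IsCompact (Set.univ.pi fun _ : Fin m => Set.univ.pi fun _ : Fin m =>
      Metric.closedBall (0 : ℂ) 1) :=
    isCompact_univ_pi fun _ => isCompact_univ_pi fun _ => isCompact_closedBall _ _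
  refine IsCompact.of_isClosed_subset (s := Set.univ.pi fun _ : Fin m =>
    Set.univ.pi fun _ : Fin m => Metric.closedBall (0 : ℂ) 1) hK
    (isClosed_unitary (R := Matrix (Fin m) (Fin m) ℂ)) ?_
  intro U hU i _ j _
  simpa using entry_norm_bound_of_unitary hU i j

/-- Lebesgue measure `(dZ)` on complex `m × r` matrices: the product over all entries of Lebesgue
measure `d(Re z) d(Im z)` on `ℂ`. -/
noncomputable def lebesgue (m r : ℕ) : Measure (Matrix (Fin m) (Fin r) ℂ) :=
  (volume : Measure (Fin m → Fin r → ℂ))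

/-- The complex Stiefel manifold of semi-unitary `m × r` matrices. -/
def stiefel (m r : ℕ) : Set (Matrix (Fin m) (Fin r) ℂ) :=
  {X | Xᴴ * X = 1}

/-- The normalized (unit mass) Haar measure of the unitary group `U(m)`. -/
noncomputable def unitaryHaar (m : ℕ) : Measure (Matrix.unitaryGroup (Fin m) ℂ) :=
  Measure.haarMeasure ⊤

/-- The normalized invariant measure `[dX]` on the complex Stiefel manifold (`r ≤ m`), as a
measure on `m × r` matrices carried by the manifold: the law of the first `r` columns of a
Haar-distributed unitary `m × m` matrix. -/
noncomputable def stiefelUniform {m r : ℕ} (h : r ≤ m) : Measure (Matrix (Fin m) (Fin r) ℂ) :=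
  (unitaryHaar m).map fun U : Matrix.unitaryGroup (Fin m) ℂ => (U : Matrix (Fin m) (Fin m) ℂ).submatrix id (Fin.castLE h)

/-- The orientation `H_Z = Z (Z̄'Z)^{-1/2}`, the semi-unitary factor of the polar decomposition of a
full column rank matrix `Z`; `CFC.sqrt` is the positive semidefinite square root. -/
noncomputable def orientation {m r : ℕ} (Z : Matrix (Fin m) (Fin r) ℂ) :
    Matrix (Fin m) (Fin r) ℂ :=
  Z * (CFC.sqrt (Zᴴ * Z))⁻¹

/-- The matrix-variate complex central normal distribution `mN^ℂ(0, I_r, P)`, with density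
`π^{-mr} |P|^{-r} exp(-tr(Z̄'P⁻¹Z))`. The determinant and the trace are real here. -/
noncomputable def complexNormal {m : ℕ} (r : ℕ) (P : Matrix (Fin m) (Fin m) ℂ) :
    Measure (Matrix (Fin m) (Fin r) ℂ) :=
  (lebesgue m r).withDensity fun Z => ENNReal.ofReal
    ((Real.pi ^ (m * r))⁻¹ * (P.det.re ^ r)⁻¹ * Real.exp (-(Zᴴ * P⁻¹ * Z).trace.re))

/-- The complex matrix angular central Gaussian distribution `CMACG(P)`: the law of the
orientation of `Z ∼ mN^ℂ(0, I_r, P)`. -/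
noncomputable def cmacg {m : ℕ} (r : ℕ) (P : Matrix (Fin m) (Fin m) ℂ) :
    Measure (Matrix (Fin m) (Fin r) ℂ) :=
  (complexNormal r P).map orientation

/-- The function `H ↦ |P|^{-r} |H̄'P⁻¹H|^{-m}`. Both determinants are positive reals when `P` is
positive definite and `H` is semi-unitary. -/
noncomputable def cmacgDensity {m r : ℕ} (P : Matrix (Fin m) (Fin m) ℂ)
    (H : Matrix (Fin m) (Fin r) ℂ) : ℝ :=
  (P.det.re ^ r)⁻¹ * ((Hᴴ * P⁻¹ * H).det.re ^ m)⁻¹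

end CMACG

namespace CMACG

/-! ### Polar decomposition and semi-unitary matrices -/

section Polar

variable {m r : ℕ}

/-! Almost every `Z` factors as `Z = H T`, with `H` its orientation and `T = (Z̄'Z)^{1/2}`. Lebesgue
measure is invariant under `Z ↦ UZ`, which sends `H` to `UH` and fixes `T`. Averaging over Haar `U`
makes `UH` uniform on the Stiefel manifold for every fixed `Z`, so the orientation has density `H ↦
∫ f(H T_Z) dZ` (`lintegral_orientation`).

To evaluate it, put `B = H̄'P⁻¹H` and `X = B^{1/2}T`. The `P⁻¹`-Gram matrix of `HT` is `TBT = X̄'X`,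
unitarily similar to `XX̄' = B^{1/2} Z̄'Z B^{1/2}`, the `P⁻¹`-Gram matrix of `P^{1/2} Z B^{1/2}`.
Right unitary invariance gives `f(HT) = f(P^{1/2} Z B^{1/2})`, and this linear substitution has
Jacobian `|P|^r |B|^m`. Hence the integral is `|P|^{-r} |B|^{-m} ∫ f`, whatever `g` is
(`lintegral_mul_sqrt_gram`). The Gaussian density is one such `f`, so the CMACG law has the same
density. -/

lemma posDef_gram_of_det_ne_zero {Z : Matrix (Fin m) (Fin r) ℂ} (h : (Zᴴ * Z).det ≠ 0) :
    (Zᴴ * Z).PosDef :=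
  (posSemidef_conjTranspose_mul_self Z).posDef_iff_det_ne_zero.2 h

lemma isUnit_det_sqrt {A : Matrix (Fin r) (Fin r) ℂ} (hA : A.PosDef) :
    IsUnit (CFC.sqrt A).det := by
  have h : (CFC.sqrt A).det * (CFC.sqrt A).det = A.det := by
    rw [← det_mul, CFC.sqrt_mul_sqrt_self A hA.posSemidef.nonneg]
  exact isUnit_iff_ne_zero.2 fun h0 => hA.det_pos.ne' (by rw [← h, h0, zero_mul])

lemma conjTranspose_sqrt (A : Matrix (Fin r) (Fin r) ℂ) : (CFC.sqrt A)ᴴ = CFC.sqrt A :=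
  (nonneg_iff_posSemidef.1 (CFC.sqrt_nonneg A)).isHermitian

lemma orientation_mul_sqrt {Z : Matrix (Fin m) (Fin r) ℂ} (h : (Zᴴ * Z).det ≠ 0) :
    orientation Z * CFC.sqrt (Zᴴ * Z) = Z := by
  rw [orientation, Matrix.mul_assoc,
    nonsing_inv_mul _ (isUnit_det_sqrt (posDef_gram_of_det_ne_zero h)), Matrix.mul_one]

lemma orientation_mem_stiefel {Z : Matrix (Fin m) (Fin r) ℂ} (h : (Zᴴ * Z).det ≠ 0) :
    orientation Z ∈ stiefel m r := by
  have hu := isUnit_det_sqrt (posDef_gram_of_det_ne_zero h)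
  have hs := CFC.sqrt_mul_sqrt_self (Zᴴ * Z) (posSemidef_conjTranspose_mul_self Z).nonneg
  change (orientation Z)ᴴ * orientation Z = 1
  rw [orientation, conjTranspose_mul, conjTranspose_nonsing_inv, conjTranspose_sqrt]
  set S := CFC.sqrt (Zᴴ * Z)
  calc S⁻¹ * Zᴴ * (Z * S⁻¹) = S⁻¹ * (Zᴴ * Z) * S⁻¹ := by simp only [Matrix.mul_assoc]
    _ = (S⁻¹ * S) * (S * S⁻¹) := by rw [← hs]; simp only [Matrix.mul_assoc]
    _ = 1 := by rw [nonsing_inv_mul _ hu, mul_nonsing_inv _ hu, Matrix.one_mul]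

lemma gram_unitary_mul {U : Matrix (Fin m) (Fin m) ℂ} (hU : U ∈ unitaryGroup (Fin m) ℂ)
    (Z : Matrix (Fin m) (Fin r) ℂ) : (U * Z)ᴴ * (U * Z) = Zᴴ * Z := by
  have h : Uᴴ * U = 1 := mem_unitaryGroup_iff'.1 hU
  rw [conjTranspose_mul, Matrix.mul_assoc, ← Matrix.mul_assoc Uᴴ, h, Matrix.one_mul]

lemma orientation_unitary_mul {U : Matrix (Fin m) (Fin m) ℂ} (hU : U ∈ unitaryGroup (Fin m) ℂ)
    (Z : Matrix (Fin m) (Fin r) ℂ) : orientation (U * Z) = U * orientation Z := by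
  rw [orientation, gram_unitary_mul hU, orientation, Matrix.mul_assoc]

lemma rank_eq_of_det_gram_ne_zero {Z : Matrix (Fin m) (Fin r) ℂ} (h : (Zᴴ * Z).det ≠ 0) :
    Z.rank = r := by
  rw [← rank_conjTranspose_mul_self, rank_of_isUnit _ ((isUnit_iff_isUnit_det _).2 h.isUnit)]
  simp

/-- The two Gram matrices of an invertible square matrix are unitarily similar. -/
lemma exists_unitary_mul_conjTranspose_self {X : Matrix (Fin r) (Fin r) ℂ} (hX : X.det ≠ 0) :
    ∃ Q ∈ unitaryGroup (Fin r) ℂ, Q * (Xᴴ * X) * Qᴴ = X * Xᴴ := by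
  have hd : (Xᴴ * X).det ≠ 0 := by simp [det_conjTranspose, hX]
  have hs := CFC.sqrt_mul_sqrt_self (Xᴴ * X) (posSemidef_conjTranspose_mul_self X).nonneg
  -- For `X = QS` with `S² = X̄'X`, one has `XX̄' = QS²Q̄'`.
  refine ⟨orientation X, mem_unitaryGroup_iff'.2 (orientation_mem_stiefel hd), ?_⟩
  conv_lhs => rw [← hs]
  conv_rhs => rw [← orientation_mul_sqrt hd]
  rw [conjTranspose_mul, conjTranspose_sqrt]
  simp only [Matrix.mul_assoc]

/-- A semi-unitary matrix consists of the first columns of a unitary matrix. -/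
lemma exists_unitary_submatrix_eq (hrm : r ≤ m) {H : Matrix (Fin m) (Fin r) ℂ}
    (hH : H ∈ stiefel m r) :
    ∃ V : unitaryGroup (Fin m) ℂ,
      (V : Matrix (Fin m) (Fin m) ℂ).submatrix id (Fin.castLE hrm) = H := by
  classical
  -- The zeros are placeholders: orthonormality is only required at indices below `r`.
  let v : Fin m → EuclideanSpace ℂ (Fin m) := fun j =>
    if h : (j : ℕ) < r then WithLp.toLp 2 (fun i => H i ⟨j, h⟩) else 0
  have hv : Orthonormal ℂ (({j : Fin m | (j : ℕ) < r}).domRestrict v) := by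
    rw [orthonormal_iff_ite]
    rintro ⟨i, hi⟩ ⟨j, hj⟩
    have hi' : (i : ℕ) < r := hi
    have hj' : (j : ℕ) < r := hj
    have := congrFun (congrFun (show Hᴴ * H = 1 from hH) ⟨i, hi'⟩) ⟨j, hj'⟩
    simp only [Matrix.mul_apply, conjTranspose_apply, one_apply, Fin.mk.injEq] at this
    simp only [Set.domRestrict_apply, v, hi', hj', dite_true, PiLp.inner_apply,
      RCLike.inner_apply, Subtype.mk.injEq, Fin.ext_iff]
    rw [← this]
    exact Finset.sum_congr rfl fun _ _ => mul_comm _ _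
  obtain ⟨b, hb⟩ := hv.exists_orthonormalBasis_extension_of_card_eq (by simp)
  have hU : (of fun i j => b j i : Matrix (Fin m) (Fin m) ℂ) ∈ unitaryGroup (Fin m) ℂ := by
    rw [mem_unitaryGroup_iff']
    ext i j
    have := orthonormal_iff_ite.1 b.orthonormal i j
    rw [PiLp.inner_apply] at this
    simp only [star_eq_conjTranspose, Matrix.mul_apply, conjTranspose_apply, of_apply, one_apply]
    rw [← this]
    exact Finset.sum_congr rfl fun _ _ => mul_comm _ _
  refine ⟨⟨_, hU⟩, ?_⟩
  ext i j
  have hj : ((Fin.castLE hrm j : Fin m) : ℕ) < r := j.2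
  simp [hb _ hj, v]

end Polar

/-! ### Measurability of the orientation -/

section Measurability

variable {m r : ℕ}

instance instSecondCountableTopologyMatrix (m r : ℕ) :
    SecondCountableTopology (Matrix (Fin m) (Fin r) ℂ) :=
  inferInstanceAs (SecondCountableTopology (Fin m → Fin r → ℂ))

-- The operator norm supplies the C⋆-algebra structure behind continuity of the square root; its
-- topology is the entrywise one.
open scoped Matrix.Norms.L2Operator in
lemma continuousOn_matrix_sqrt :
    ContinuousOn (CFC.sqrt : Matrix (Fin r) (Fin r) ℂ → Matrix (Fin r) (Fin r) ℂ)
      {A | 0 ≤ A} :=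
  CFC.continuousOn_sqrt

lemma continuous_sqrt_gram :
    Continuous fun Z : Matrix (Fin m) (Fin r) ℂ => CFC.sqrt (Zᴴ * Z) :=
  continuousOn_matrix_sqrt.comp_continuous (by fun_prop)
    fun Z => (posSemidef_conjTranspose_mul_self Z).nonneg

lemma measurable_entry {α : Type*} [MeasurableSpace α] {F : α → Matrix (Fin m) (Fin r) ℂ}
    (hF : Measurable F) (i : Fin m) (j : Fin r) : Measurable fun x => F x i j :=
  (measurable_pi_apply j).comp ((measurable_pi_apply i).comp hF)

lemma measurable_matrix_inv :
    Measurable fun A : Matrix (Fin r) (Fin r) ℂ => A⁻¹ := by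
  have h1 : Measurable fun A : Matrix (Fin r) (Fin r) ℂ => A.det :=
    (continuous_id.matrix_det).measurable
  have h2 : Measurable fun A : Matrix (Fin r) (Fin r) ℂ => A.adjugate :=
    (continuous_id.matrix_adjugate).measurable
  refine measurable_pi_iff.2 fun i => measurable_pi_iff.2 fun j => ?_
  simp only [inv_def, Matrix.smul_apply, Ring.inverse_eq_inv', smul_eq_mul]
  exact h1.inv.mul (measurable_entry h2 i j)

lemma measurable_orientation : Measurable (orientation (m := m) (r := r)) := by
  have h : Measurable fun Z : Matrix (Fin m) (Fin r) ℂ => (CFC.sqrt (Zᴴ * Z))⁻¹ :=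
    measurable_matrix_inv.comp continuous_sqrt_gram.measurable
  refine measurable_pi_iff.2 fun i => measurable_pi_iff.2 fun j => ?_
  simp only [orientation, Matrix.mul_apply]
  refine Finset.measurable_sum _ fun k _ => ?_
  exact (measurable_entry measurable_id i k).mul (measurable_entry h k j)

end Measurability

/-! ### Full rank almost everywhere -/

section Lebesgue

variable {m r : ℕ}

instance instIsAddHaarMeasureVolume (m r : ℕ) :
    (volume : Measure (Fin m → Fin r → ℂ)).IsAddHaarMeasure :=
  haveI : (volume : Measure (Fin r → ℂ)).IsAddHaarMeasure :=
    Measure.pi.isAddHaarMeasure fun _ => (volume : Measure ℂ)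
  Measure.pi.isAddHaarMeasure fun _ => (volume : Measure (Fin r → ℂ))

instance instSigmaFiniteLebesgue (m r : ℕ) : SigmaFinite (lebesgue m r) :=
  inferInstanceAs (SigmaFinite (volume : Measure (Fin m → Fin r → ℂ)))

/-- The determinant is the characteristic polynomial of `-A` at `t`, which is monic. -/
lemma finite_det_add_smul_one_eq_zero (A : Matrix (Fin r) (Fin r) ℂ) :
    {t : ℝ | (A + (t : ℂ) • (1 : Matrix (Fin r) (Fin r) ℂ)).det = 0}.Finite := by
  have h : {z : ℂ | (-A).charpoly.IsRoot z}.Finite :=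
    Polynomial.finite_setOfPred_isRoot (charpoly_monic _).ne_zero
  refine (h.preimage Complex.ofReal_injective.injOn).subset fun t ht => ?_
  change Polynomial.eval _ _ = 0
  rw [eval_charpoly, ← (show _ = (0 : ℂ) from ht), sub_neg_eq_add, add_comm,
    scalar_apply, ← smul_one_eq_diagonal]

/-- On each line in the direction `E`, whose top block is the identity, the determinant vanishes at
finitely many points; a set null along all parallel lines is Lebesgue null. -/
lemma ae_det_submatrix_ne_zero (hrm : r ≤ m) :
    ∀ᵐ Z ∂lebesgue m r, (Z.submatrix (Fin.castLE hrm) id).det ≠ 0 := by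
  let E : Matrix (Fin m) (Fin r) ℂ := of fun i j => if (i : ℕ) = j then 1 else 0
  let L : ℝ →ₗ[ℝ] (Fin m → Fin r → ℂ) := LinearMap.toSpanSingleton ℝ _ E
  have hs : MeasurableSet {Z : Fin m → Fin r → ℂ |
      (Matrix.submatrix (of Z) (Fin.castLE hrm) id).det ≠ 0} := by
    refine (isOpen_ne_fun ?_ continuous_const).measurableSet
    exact ((continuous_id (X := Matrix (Fin m) (Fin r) ℂ)).matrix_submatrix _ _).matrix_det
  refine ae_mem_of_ae_add_linearMap_mem (s := {Z : Fin m → Fin r → ℂ |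
    (Matrix.submatrix (of Z) (Fin.castLE hrm) id).det ≠ 0}) L (volume : Measure ℝ)
    (volume : Measure (Fin m → Fin r → ℂ)) hs fun Y => ?_
  have hfin := finite_det_add_smul_one_eq_zero (Matrix.submatrix (of Y) (Fin.castLE hrm) id)
  refine measure_mono_null (fun t ht => ?_) (hfin.measure_zero volume)
  have ht' := not_not.1 ht
  change _ = _ at ht' ⊢
  rw [← ht']
  congr 1
  ext i j
  change Y (Fin.castLE hrm i) j + (t : ℂ) * (1 : Matrix (Fin r) (Fin r) ℂ) i j =
    (of Y + t • E) (Fin.castLE hrm i) j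
  simp [E, one_apply, Fin.ext_iff]

lemma ae_det_gram_ne_zero (hrm : r ≤ m) : ∀ᵐ Z ∂lebesgue m r, (Zᴴ * Z).det ≠ 0 := by
  filter_upwards [ae_det_submatrix_ne_zero hrm] with Z hZ
  refine (PosDef.conjTranspose_mul_self Z fun x y hxy => ?_).det_pos.ne'
  have hinj := mulVec_injective_of_isUnit ((isUnit_iff_isUnit_det _).2 hZ.isUnit)
  refine hinj (funext fun i => ?_)
  exact congrFun hxy (Fin.castLE hrm i)

end Lebesgue

/-! ### Jacobians of linear substitutions -/

section LinearChange

variable {m r : ℕ}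

/-- Each of the `m` rows is transformed separately by `Cᵀ`. -/
lemma det_mulRightLinearMap (C : Matrix (Fin r) (Fin r) ℂ) :
    LinearMap.det (mulRightLinearMap (Fin m) ℂ C) = C.det ^ m := by
  have h : mulRightLinearMap (Fin m) ℂ C =
      LinearMap.pi fun i : Fin m => (toLin' Cᵀ).comp (LinearMap.proj (φ := fun _ => Fin r → ℂ) i) := by
    ext Z i j
    change (Z * C) i j = (Cᵀ *ᵥ Z i) j
    simp [Matrix.mul_apply, mulVec, dotProduct, mul_comm]
  have h2 := LinearMap.det_pi fun _ : Fin m => toLin' Cᵀ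
  simp only [LinearMap.det_toLin', det_transpose, Finset.prod_const, Finset.card_univ,
    Fintype.card_fin] at h2
  rw [← h2, h]
  rfl

lemma det_mulLeftLinearMap (A : Matrix (Fin m) (Fin m) ℂ) :
    LinearMap.det (mulLeftLinearMap (Fin r) ℂ A) = A.det ^ r := by
  rw [← det_transpose A, ← det_mulRightLinearMap (m := r) Aᵀ,
    ← LinearMap.det_conj _ (transposeLinearEquiv (Fin r) (Fin m) ℂ ℂ)]
  congr 1
  ext Z i j
  change (A * Z) i j = (Zᵀ * Aᵀ) j i
  rw [← Matrix.transpose_mul, transpose_apply]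

/-- The real determinant of a complex-linear map is the squared modulus of its complex determinant.
-/
lemma map_mul_mul_lebesgue {A : Matrix (Fin m) (Fin m) ℂ} {C : Matrix (Fin r) (Fin r) ℂ}
    (hA : A.det ≠ 0) (hC : C.det ≠ 0) :
    (lebesgue m r).map (fun Z => A * Z * C) =
      ENNReal.ofReal (Complex.normSq A.det ^ r * Complex.normSq C.det ^ m)⁻¹ •
        lebesgue m r := by
  let L : Matrix (Fin m) (Fin r) ℂ →ₗ[ℂ] Matrix (Fin m) (Fin r) ℂ :=
    mulRightLinearMap (Fin m) ℂ C ∘ₗ mulLeftLinearMap (Fin r) ℂ A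
  have hL : LinearMap.det (L.restrictScalars ℝ) =
      Complex.normSq A.det ^ r * Complex.normSq C.det ^ m := by
    rw [LinearMap.det_restrictScalars, Algebra.norm_complex_apply, LinearMap.det_comp,
      det_mulRightLinearMap, det_mulLeftLinearMap, map_mul, map_pow, map_pow, mul_comm]
  have hpos : 0 < Complex.normSq A.det ^ r * Complex.normSq C.det ^ m :=
    mul_pos (pow_pos (Complex.normSq_pos.2 hA) _) (pow_pos (Complex.normSq_pos.2 hC) _)
  have := Measure.map_linearMap_addHaar_eq_smul_addHaar (E := Fin m → Fin r → ℂ)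
    (f := L.restrictScalars ℝ) (volume : Measure (Fin m → Fin r → ℂ))
    (by change LinearMap.det (L.restrictScalars ℝ) ≠ 0; rw [hL]; exact hpos.ne')
  rw [← abs_of_pos (inv_pos.2 hpos), ← hL]
  exact this

lemma continuous_mul_mul (A : Matrix (Fin m) (Fin m) ℂ) (C : Matrix (Fin r) (Fin r) ℂ) :
    Continuous fun Z : Matrix (Fin m) (Fin r) ℂ => A * Z * C := by fun_prop

lemma lintegral_mul_mul {A : Matrix (Fin m) (Fin m) ℂ} {C : Matrix (Fin r) (Fin r) ℂ}
    (hA : A.det ≠ 0) (hC : C.det ≠ 0) {F : Matrix (Fin m) (Fin r) ℂ → ENNReal}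
    (hF : Measurable F) :
    ∫⁻ Z, F (A * Z * C) ∂lebesgue m r =
      ENNReal.ofReal (Complex.normSq A.det ^ r * Complex.normSq C.det ^ m)⁻¹ *
        ∫⁻ Z, F Z ∂lebesgue m r := by
  rw [← lintegral_map hF (continuous_mul_mul A C).measurable, map_mul_mul_lebesgue hA hC,
    lintegral_smul_measure, smul_eq_mul]

lemma lintegral_unitary_mul {U : Matrix (Fin m) (Fin m) ℂ} (hU : U ∈ unitaryGroup (Fin m) ℂ)
    {F : Matrix (Fin m) (Fin r) ℂ → ENNReal} (hF : Measurable F) :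
    ∫⁻ Z, F (U * Z) ∂lebesgue m r = ∫⁻ Z, F Z ∂lebesgue m r := by
  have h1 : Complex.normSq U.det = 1 := by
    have h := Unitary.mem_iff_star_mul_self.1 (det_of_mem_unitary hU)
    rw [← Complex.ofReal_inj, Complex.normSq_eq_conj_mul_self]
    exact h
  have h0 : U.det ≠ 0 := fun h => by simp [h] at h1
  have := lintegral_mul_mul (r := r) h0 (C := 1) (by simp) hF
  simpa [h1] using this

end LinearChange

/-! ### Haar measure on the unitary group -/

section Haar

variable {m r : ℕ}

instance instIsProbabilityMeasureUnitaryHaar (m : ℕ) : IsProbabilityMeasure (unitaryHaar m) :=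
  ⟨Measure.haarMeasure_self⟩

instance instIsHaarMeasureUnitaryHaar (m : ℕ) : (unitaryHaar m).IsHaarMeasure :=
  inferInstanceAs (Measure.haarMeasure _).IsHaarMeasure

instance instIsMulRightInvariantUnitaryHaar (m : ℕ) : (unitaryHaar m).IsMulRightInvariant where
  map_mul_right_eq_self g := by
    -- A right translate of Haar measure is again a Haar probability measure, hence equal to it by
    -- uniqueness.
    have : IsProbabilityMeasure ((unitaryHaar m).map (· * g)) :=
      Measure.isProbabilityMeasure_map (measurable_mul_const g).aemeasurable
    exact Measure.isHaarMeasure_eq_of_isProbabilityMeasure _ _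

lemma continuous_firstColumns (hrm : r ≤ m) :
    Continuous fun U : unitaryGroup (Fin m) ℂ =>
      (U : Matrix (Fin m) (Fin m) ℂ).submatrix id (Fin.castLE hrm) :=
  continuous_subtype_val.matrix_submatrix _ _

lemma firstColumns_mem_stiefel (hrm : r ≤ m) (U : unitaryGroup (Fin m) ℂ) :
    (U : Matrix (Fin m) (Fin m) ℂ).submatrix id (Fin.castLE hrm) ∈ stiefel m r := by
  have hU : (U : Matrix (Fin m) (Fin m) ℂ)ᴴ * U = 1 := mem_unitaryGroup_iff'.1 U.2
  change _ * _ = _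
  rw [conjTranspose_submatrix, ← submatrix_mul _ _ _ _ _ Function.bijective_id, hU]
  exact submatrix_one _ (Fin.castLE_injective hrm)

/-- Completing `H` to a unitary `V`, `UH` is the first columns of `UV`, and right invariance removes
`V`. -/
lemma lintegral_unitary_mul_stiefel (hrm : r ≤ m) {H : Matrix (Fin m) (Fin r) ℂ}
    (hH : H ∈ stiefel m r) (F : Matrix (Fin m) (Fin r) ℂ → ENNReal) :
    ∫⁻ U : unitaryGroup (Fin m) ℂ, F ((U : Matrix (Fin m) (Fin m) ℂ) * H) ∂unitaryHaar m =
      ∫⁻ U : unitaryGroup (Fin m) ℂ,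
        F ((U : Matrix (Fin m) (Fin m) ℂ).submatrix id (Fin.castLE hrm)) ∂unitaryHaar m := by
  obtain ⟨V, rfl⟩ := exists_unitary_submatrix_eq hrm hH
  exact lintegral_mul_right_eq_self (fun U : unitaryGroup (Fin m) ℂ =>
    F ((U : Matrix (Fin m) (Fin m) ℂ).submatrix id (Fin.castLE hrm))) V

end Haar

/-! ### The radial integral -/

section Density

variable {m r : ℕ} {P : Matrix (Fin m) (Fin m) ℂ}

lemma posDef_conj_of_mem_stiefel (hP : P.PosDef) {H : Matrix (Fin m) (Fin r) ℂ}
    (hH : H ∈ stiefel m r) : (Hᴴ * P⁻¹ * H).PosDef := by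
  refine hP.inv.conjTranspose_mul_mul_same fun x y hxy => ?_
  have h : Hᴴ * H = 1 := hH
  rw [← one_mulVec x, ← one_mulVec y, ← h, ← mulVec_mulVec, ← mulVec_mulVec, hxy]

lemma normSq_det_sqrt {A : Matrix (Fin r) (Fin r) ℂ} (hA : A.PosDef) :
    Complex.normSq (CFC.sqrt A).det = A.det.re := by
  have h : (CFC.sqrt A).det * (CFC.sqrt A).det = A.det := by
    rw [← det_mul, CFC.sqrt_mul_sqrt_self A hA.posSemidef.nonneg]
  have h2 : ‖A.det‖ = A.det.re := by
    conv_rhs => rw [← RCLike.norm_of_nonneg' hA.det_pos.le]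
    exact (Complex.ofReal_re _).symm
  rw [← h2, ← h, norm_mul, Complex.normSq_eq_norm_sq, sq]

lemma det_re_pos {A : Matrix (Fin r) (Fin r) ℂ} (hA : A.PosDef) : 0 < A.det.re :=
  (Complex.pos_iff.1 hA.det_pos).1

lemma normSq_det_inv_sqrt_inv (hP : P.PosDef) :
    Complex.normSq (CFC.sqrt P⁻¹)⁻¹.det = P.det.re := by
  rw [hP.inv.posSemidef.inv_sqrt,
    nonsing_inv_nonsing_inv _ ((isUnit_iff_isUnit_det _).1 hP.isUnit), normSq_det_sqrt hP]

lemma conj_sqrt_inv_mul (hP : P.PosDef) (W : Matrix (Fin m) (Fin r) ℂ) :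
    ((CFC.sqrt P⁻¹)⁻¹ * W)ᴴ * P⁻¹ * ((CFC.sqrt P⁻¹)⁻¹ * W) = Wᴴ * W := by
  have hu := isUnit_det_sqrt hP.inv
  rw [conjTranspose_mul, conjTranspose_nonsing_inv, conjTranspose_sqrt]
  conv_lhs => enter [1, 2]; rw [← CFC.sqrt_mul_sqrt_self P⁻¹ hP.inv.posSemidef.nonneg]
  set S := CFC.sqrt P⁻¹
  calc Wᴴ * S⁻¹ * (S * S) * (S⁻¹ * W) = Wᴴ * (S⁻¹ * S) * ((S * S⁻¹) * W) := by
        simp only [Matrix.mul_assoc]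
    _ = Wᴴ * W := by rw [nonsing_inv_mul _ hu, mul_nonsing_inv _ hu, Matrix.one_mul, Matrix.mul_one]

/-- The integral over the radial part of a density that depends on `X` only through `X̄'P⁻¹X`. -/
lemma lintegral_mul_sqrt_gram (hrm : r ≤ m) (hP : P.PosDef)
    {f : Matrix (Fin m) (Fin r) ℂ → ℝ}
    (hf : ∀ X Y, Xᴴ * P⁻¹ * X = Yᴴ * P⁻¹ * Y → f X = f Y) (hf_meas : Measurable f)
    (hf_inv : ∀ Q ∈ unitaryGroup (Fin r) ℂ, ∀ X, f (X * Q) = f X)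
    {H : Matrix (Fin m) (Fin r) ℂ} (hH : H ∈ stiefel m r) :
    ∫⁻ Z, ENNReal.ofReal (f (H * CFC.sqrt (Zᴴ * Z))) ∂lebesgue m r =
      ENNReal.ofReal (cmacgDensity P H) * ∫⁻ Z, ENNReal.ofReal (f Z) ∂lebesgue m r := by
  have hB := posDef_conj_of_mem_stiefel hP hH
  set B := Hᴴ * P⁻¹ * H with hBdef
  have hC := isUnit_det_sqrt hB
  have hA := isUnit_det_sqrt hP.inv
  have hA' : (CFC.sqrt P⁻¹)⁻¹.det ≠ 0 := by
    rw [det_nonsing_inv]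
    exact (hA.ringInverse).ne_zero
  have key : ∀ᵐ Z ∂lebesgue m r, f (H * CFC.sqrt (Zᴴ * Z)) =
      f ((CFC.sqrt P⁻¹)⁻¹ * Z * CFC.sqrt B) := by
    filter_upwards [ae_det_gram_ne_zero hrm] with Z hZ
    have hT := isUnit_det_sqrt (posDef_gram_of_det_ne_zero hZ)
    have hTT := CFC.sqrt_mul_sqrt_self _ (posSemidef_conjTranspose_mul_self Z).nonneg
    have hCC := CFC.sqrt_mul_sqrt_self B hB.posSemidef.nonneg
    obtain ⟨Q, hQ, hQX⟩ := exists_unitary_mul_conjTranspose_self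
      (X := CFC.sqrt B * CFC.sqrt (Zᴴ * Z)) (by rw [det_mul]; exact (hC.mul hT).ne_zero)
    -- The factor `Q̄'` turns similarity of the two `P⁻¹`-Gram matrices into equality.
    rw [← hf_inv Qᴴ (Unitary.star_mem hQ)]
    refine hf _ _ ?_
    rw [Matrix.mul_assoc (CFC.sqrt P⁻¹)⁻¹, conj_sqrt_inv_mul hP]
    simp only [conjTranspose_mul, conjTranspose_sqrt, conjTranspose_conjTranspose] at hQX ⊢
    set T := CFC.sqrt (Zᴴ * Z)
    set C := CFC.sqrt B
    calc Q * (T * Hᴴ) * P⁻¹ * (H * T * Qᴴ) = Q * (T * B * T) * Qᴴ := by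
          simp only [hBdef, Matrix.mul_assoc]
      _ = Q * (T * C * (C * T)) * Qᴴ := by rw [← hCC]; simp only [Matrix.mul_assoc]
      _ = C * (T * T) * C := by rw [hQX]; simp only [Matrix.mul_assoc]
      _ = C * Zᴴ * (Z * C) := by rw [hTT]; simp only [Matrix.mul_assoc]
  rw [lintegral_congr_ae (key.mono fun Z hZ => congrArg ENNReal.ofReal hZ),
    lintegral_mul_mul (F := fun Z => ENNReal.ofReal (f Z)) hA' hC.ne_zero
      (ENNReal.measurable_ofReal.comp hf_meas),
    normSq_det_inv_sqrt_inv hP, normSq_det_sqrt hB, cmacgDensity, mul_inv]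

end Density

/-! ### Polar coordinates and the law of the orientation -/

section Law

variable {m r : ℕ} {P : Matrix (Fin m) (Fin m) ℂ}

lemma measurable_cmacgDensity (P : Matrix (Fin m) (Fin m) ℂ) :
    Measurable fun H : Matrix (Fin m) (Fin r) ℂ => ENNReal.ofReal (cmacgDensity P H) := by
  have h : Continuous fun H : Matrix (Fin m) (Fin r) ℂ => (Hᴴ * P⁻¹ * H).det.re :=
    Complex.continuous_re.comp (Continuous.matrix_det (by fun_prop))
  exact ((h.measurable.pow_const m).inv.const_mul _).ennreal_ofReal

/-- Integration in polar coordinates: the unitarily invariant Lebesgue measure on matrices is the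
image of the product of the uniform measure on the Stiefel manifold and the law of the radial
part. -/
lemma lintegral_orientation (hrm : r ≤ m) {φ F : Matrix (Fin m) (Fin r) ℂ → ENNReal}
    (hφ : Measurable φ) (hF : Measurable F) :
    ∫⁻ Z, φ (orientation Z) * F Z ∂lebesgue m r =
      ∫⁻ H, φ H * ∫⁻ Z, F (H * CFC.sqrt (Zᴴ * Z)) ∂lebesgue m r ∂stiefelUniform hrm := by
  have hmeas : Measurable fun p : Matrix (Fin m) (Fin r) ℂ × Matrix (Fin m) (Fin r) ℂ =>
      F (p.1 * CFC.sqrt (p.2ᴴ * p.2)) := by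
    refine hF.comp (Continuous.measurable ?_)
    exact continuous_fst.matrix_mul (continuous_sqrt_gram.comp continuous_snd)
  have hinner : Measurable fun H : Matrix (Fin m) (Fin r) ℂ =>
      ∫⁻ Z, F (H * CFC.sqrt (Zᴴ * Z)) ∂lebesgue m r := hmeas.lintegral_prod_right'
  have hcol := (continuous_firstColumns hrm).measurable
  have hmul : Measurable fun p : unitaryGroup (Fin m) ℂ × Matrix (Fin m) (Fin r) ℂ =>
      (p.1 : Matrix (Fin m) (Fin m) ℂ) * p.2 := by
    refine Continuous.measurable ?_
    exact (continuous_subtype_val.comp continuous_fst).matrix_mul continuous_snd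
  have hG : Measurable fun Z => φ (orientation Z) * F Z :=
    (hφ.comp measurable_orientation).mul hF
  calc ∫⁻ Z, φ (orientation Z) * F Z ∂lebesgue m r
      = ∫⁻ U : unitaryGroup (Fin m) ℂ, ∫⁻ Z,
          φ (orientation ((U : Matrix (Fin m) (Fin m) ℂ) * Z)) *
            F ((U : Matrix (Fin m) (Fin m) ℂ) * Z) ∂lebesgue m r ∂unitaryHaar m := by
        -- The inner integral does not depend on `U`, and Haar measure has mass one.
        rw [lintegral_congr fun U : unitaryGroup (Fin m) ℂ => lintegral_unitary_mul U.2 hG]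
        simp
    _ = ∫⁻ Z, ∫⁻ U : unitaryGroup (Fin m) ℂ,
          φ (orientation ((U : Matrix (Fin m) (Fin m) ℂ) * Z)) *
            F ((U : Matrix (Fin m) (Fin m) ℂ) * Z) ∂unitaryHaar m ∂lebesgue m r :=
        lintegral_lintegral_swap (hG.comp hmul).aemeasurable
    _ = ∫⁻ Z, ∫⁻ U : unitaryGroup (Fin m) ℂ,
          φ ((U : Matrix (Fin m) (Fin m) ℂ).submatrix id (Fin.castLE hrm)) *
            F ((U : Matrix (Fin m) (Fin m) ℂ).submatrix id (Fin.castLE hrm) *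
              CFC.sqrt (Zᴴ * Z)) ∂unitaryHaar m ∂lebesgue m r := by
        refine lintegral_congr_ae ?_
        filter_upwards [ae_det_gram_ne_zero hrm] with Z hZ
        refine Eq.trans (lintegral_congr fun U => ?_)
          (lintegral_unitary_mul_stiefel hrm (orientation_mem_stiefel hZ)
            fun H => φ H * F (H * CFC.sqrt (Zᴴ * Z)))
        rw [orientation_unitary_mul U.2, Matrix.mul_assoc, orientation_mul_sqrt hZ]
    _ = ∫⁻ U : unitaryGroup (Fin m) ℂ, ∫⁻ Z,
          φ ((U : Matrix (Fin m) (Fin m) ℂ).submatrix id (Fin.castLE hrm)) *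
            F ((U : Matrix (Fin m) (Fin m) ℂ).submatrix id (Fin.castLE hrm) *
              CFC.sqrt (Zᴴ * Z)) ∂lebesgue m r ∂unitaryHaar m := by
        refine (lintegral_lintegral_swap ?_).symm
        exact ((hφ.comp (hcol.comp measurable_fst)).mul
          (hmeas.comp ((hcol.comp measurable_fst).prodMk measurable_snd))).aemeasurable
    _ = ∫⁻ H, φ H * ∫⁻ Z, F (H * CFC.sqrt (Zᴴ * Z)) ∂lebesgue m r ∂stiefelUniform hrm := by
        refine Eq.trans (lintegral_congr fun U => ?_)
          (lintegral_map (hφ.mul hinner) hcol).symm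
        exact lintegral_const_mul _ (hmeas.comp (measurable_const.prodMk measurable_id))

lemma ae_mem_stiefel (hrm : r ≤ m) : ∀ᵐ H ∂stiefelUniform (m := m) hrm, H ∈ stiefel m r := by
  refine (ae_map_iff (continuous_firstColumns hrm).aemeasurable ?_).2
    (Filter.Eventually.of_forall (firstColumns_mem_stiefel hrm))
  exact (isClosed_eq (f := fun X : Matrix (Fin m) (Fin r) ℂ => Xᴴ * X) (by fun_prop)
    continuous_const).measurableSet

lemma map_orientation_withDensity (hrm : r ≤ m) (hP : P.PosDef)
    {f : Matrix (Fin m) (Fin r) ℂ → ℝ}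
    (hf : ∀ X Y, Xᴴ * P⁻¹ * X = Yᴴ * P⁻¹ * Y → f X = f Y) (hf_meas : Measurable f)
    (hf_inv : ∀ Q ∈ unitaryGroup (Fin r) ℂ, ∀ X, f (X * Q) = f X)
    (hf_one : ∫⁻ Z, ENNReal.ofReal (f Z) ∂lebesgue m r = 1) :
    ((lebesgue m r).withDensity fun X => ENNReal.ofReal (f X)).map orientation =
      (stiefelUniform hrm).withDensity fun H => ENNReal.ofReal (cmacgDensity P H) := by
  refine Measure.ext_of_lintegral _ fun φ hφ => ?_
  rw [lintegral_map hφ measurable_orientation,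
    lintegral_withDensity_eq_lintegral_mul _ hf_meas.ennreal_ofReal
      (show Measurable fun Z => φ (orientation Z) from hφ.comp measurable_orientation),
    lintegral_withDensity_eq_lintegral_mul _ (measurable_cmacgDensity P) hφ]
  simp only [Pi.mul_apply]
  simp only [mul_comm (ENNReal.ofReal _)]
  rw [lintegral_orientation hrm hφ hf_meas.ennreal_ofReal]
  refine lintegral_congr_ae ?_
  filter_upwards [ae_mem_stiefel hrm] with H hH
  rw [lintegral_mul_sqrt_gram hrm hP hf hf_meas hf_inv hH, hf_one, mul_one]

end Law

/-! ### The Gaussian case -/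

section Gaussian

variable {m r : ℕ} {P : Matrix (Fin m) (Fin m) ℂ}

lemma trace_gram_re (W : Matrix (Fin m) (Fin r) ℂ) :
    (Wᴴ * W).trace.re = ∑ i, ∑ j, ‖W i j‖ ^ 2 := by
  rw [Finset.sum_comm]
  simp only [Matrix.trace, diag_apply, Matrix.mul_apply, conjTranspose_apply, Complex.re_sum]
  refine Finset.sum_congr rfl fun j _ => Finset.sum_congr rfl fun i _ => ?_
  rw [← Complex.normSq_eq_norm_sq, ← Complex.ofReal_re (Complex.normSq _),
    Complex.normSq_eq_conj_mul_self]
  rfl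

lemma integral_exp_neg_norm_sq : ∫ z : ℂ, Real.exp (-‖z‖ ^ 2) = Real.pi := by
  simpa using GaussianFourier.integral_rexp_neg_mul_sq_norm (V := ℂ) one_pos

lemma integrable_exp_neg_norm_sq : Integrable fun z : ℂ => Real.exp (-‖z‖ ^ 2) :=
  -- A non-integrable function would have integral zero by convention.
  Integrable.of_integral_ne_zero (by rw [integral_exp_neg_norm_sq]; exact Real.pi_ne_zero)

lemma lintegral_exp_neg_trace_gram (m r : ℕ) :
    ∫⁻ W, ENNReal.ofReal (Real.exp (-(Wᴴ * W).trace.re)) ∂lebesgue m r =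
      ENNReal.ofReal (Real.pi ^ (m * r)) := by
  have hprod : ∀ W : Matrix (Fin m) (Fin r) ℂ,
      Real.exp (-(Wᴴ * W).trace.re) = ∏ i, ∏ j, Real.exp (-‖W i j‖ ^ 2) := fun W => by
    simp only [trace_gram_re, ← Real.exp_sum, Finset.sum_neg_distrib]
  have hrow : Integrable fun w : Fin r → ℂ => ∏ j, Real.exp (-‖w j‖ ^ 2) :=
    Integrable.fintype_prod fun _ => integrable_exp_neg_norm_sq
  have hint : Integrable (fun W : Fin m → Fin r → ℂ => ∏ i, ∏ j, Real.exp (-‖W i j‖ ^ 2)) :=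
    Integrable.fintype_prod (f := fun _ (w : Fin r → ℂ) => ∏ j, Real.exp (-‖w j‖ ^ 2))
      fun _ => hrow
  simp only [hprod]
  refine (ofReal_integral_eq_lintegral_ofReal hint (Filter.Eventually.of_forall fun W =>
    Finset.prod_nonneg fun i _ => Finset.prod_nonneg fun j _ => (Real.exp_pos _).le)).symm.trans ?_
  rw [integral_fintype_prod_volume_eq_pow fun w : Fin r → ℂ => ∏ j, Real.exp (-‖w j‖ ^ 2),
    integral_fintype_prod_volume_eq_pow fun z : ℂ => Real.exp (-‖z‖ ^ 2),
    integral_exp_neg_norm_sq, Fintype.card_fin, Fintype.card_fin, ← pow_mul, mul_comm]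

lemma continuous_exp_neg_trace (P : Matrix (Fin m) (Fin m) ℂ) :
    Continuous fun Z : Matrix (Fin m) (Fin r) ℂ => Real.exp (-(Zᴴ * P⁻¹ * Z).trace.re) :=
  Real.continuous_exp.comp
    (Complex.continuous_re.comp (Continuous.matrix_trace (by fun_prop))).neg

/-- Substituting `Z = P^{1/2}W` reduces this to the case `P = 1`. -/
lemma lintegral_exp_neg_trace (hP : P.PosDef) :
    ∫⁻ Z, ENNReal.ofReal (Real.exp (-(Zᴴ * P⁻¹ * Z).trace.re)) ∂lebesgue m r =
      ENNReal.ofReal (P.det.re ^ r * Real.pi ^ (m * r)) := by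
  have hdet := normSq_det_inv_sqrt_inv hP
  have hpos := pow_pos (det_re_pos hP) r
  have hA : (CFC.sqrt P⁻¹)⁻¹.det ≠ 0 := by
    rw [← Complex.normSq_pos, hdet]
    exact det_re_pos hP
  have h := lintegral_mul_mul (r := r) hA (C := 1) (by simp)
    (continuous_exp_neg_trace P).measurable.ennreal_ofReal
  simp only [Matrix.mul_one, conj_sqrt_inv_mul hP, lintegral_exp_neg_trace_gram, hdet, det_one,
    map_one, one_pow, mul_one] at h
  rw [ENNReal.ofReal_mul hpos.le, h, ← mul_assoc, ← ENNReal.ofReal_mul hpos.le,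
    mul_inv_cancel₀ hpos.ne', ENNReal.ofReal_one, one_mul]

lemma cmacg_eq_withDensity (hrm : r ≤ m) (hP : P.PosDef) :
    cmacg r P =
      (stiefelUniform hrm).withDensity fun H => ENNReal.ofReal (cmacgDensity P H) := by
  refine map_orientation_withDensity hrm hP (fun X Y h => by rw [h])
    ((continuous_exp_neg_trace P).measurable.const_mul _) (fun Q hQ X => ?_) ?_
  · have hQ' : Q * Qᴴ = 1 := mem_unitaryGroup_iff.1 hQ
    have htr : ((X * Q)ᴴ * P⁻¹ * (X * Q)).trace = (Xᴴ * P⁻¹ * X).trace := by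
      rw [← Matrix.mul_assoc _ X Q, trace_mul_comm, conjTranspose_mul]
      simp only [← Matrix.mul_assoc]
      rw [hQ', Matrix.one_mul]
    rw [htr]
  · have hpos := pow_pos (det_re_pos hP) r
    have hpi := pow_pos Real.pi_pos (m * r)
    have hc : 0 ≤ (Real.pi ^ (m * r))⁻¹ * (P.det.re ^ r)⁻¹ := by positivity
    simp only [ENNReal.ofReal_mul hc]
    rw [lintegral_const_mul _ (continuous_exp_neg_trace P).measurable.ennreal_ofReal,
      lintegral_exp_neg_trace hP, ← ENNReal.ofReal_mul hc, ← ENNReal.ofReal_one]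
    congr 1
    field_simp

end Gaussian

end CMACG

theorem mainTheorem5 {m r : ℕ} (hrm : r ≤ m)
    {Ω : Type*} [MeasurableSpace Ω] (μ : Measure Ω) [IsProbabilityMeasure μ]
    (P : Matrix (Fin m) (Fin m) ℂ) (hP : P.PosDef)
    (g : Matrix (Fin r) (Fin r) ℂ → ℝ)
    (f : Matrix (Fin m) (Fin r) ℂ → ℝ)
    (hf : ∀ X, f X = (P.det.re ^ r)⁻¹ * g (Xᴴ * P⁻¹ * X))
    (hf_meas : Measurable f) (hf_nonneg : ∀ X, 0 ≤ f X)
    (hf_inv : ∀ Q ∈ Matrix.unitaryGroup (Fin r) ℂ, ∀ X, f (X * Q) = f X)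
    (Z : Ω → Matrix (Fin m) (Fin r) ℂ)
    (hZ : HasLaw Z ((CMACG.lebesgue m r).withDensity fun X => ENNReal.ofReal (f X)) μ) :
    (∀ᵐ ω ∂μ, (Z ω).rank = r ∧ CMACG.orientation (Z ω) ∈ CMACG.stiefel m r) ∧
    HasLaw (fun ω => CMACG.orientation (Z ω)) (CMACG.cmacg r P) μ ∧
    HasLaw (fun ω => CMACG.orientation (Z ω))
      ((CMACG.stiefelUniform hrm).withDensity fun H =>
        ENNReal.ofReal (CMACG.cmacgDensity P H)) μ := by
  have hmeas : Measurable fun X => ENNReal.ofReal (f X) := hf_meas.ennreal_ofReal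
  -- Normalization of `f` is not assumed: it follows because `f` is the density of the law of `Z`.
  have hone : ∫⁻ X, ENNReal.ofReal (f X) ∂CMACG.lebesgue m r = 1 := by
    have := Measure.isProbabilityMeasure_map (μ := μ) hZ.aemeasurable
    rw [hZ.map_eq] at this
    rw [← setLIntegral_univ, ← withDensity_apply _ MeasurableSet.univ]
    exact this.measure_univ
  have hlaw : HasLaw (fun ω => CMACG.orientation (Z ω))
      ((CMACG.stiefelUniform hrm).withDensity fun H =>
        ENNReal.ofReal (CMACG.cmacgDensity P H)) μ := by
    refine ⟨CMACG.measurable_orientation.comp_aemeasurable hZ.aemeasurable, ?_⟩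
    rw [← CMACG.map_orientation_withDensity hrm hP (fun X Y h => by rw [hf, hf, h]) hf_meas
      hf_inv hone, ← hZ.map_eq,
      AEMeasurable.map_map_of_aemeasurable CMACG.measurable_orientation.aemeasurable
        hZ.aemeasurable]
    rfl
  refine ⟨?_, CMACG.cmacg_eq_withDensity hrm hP ▸ hlaw, hlaw⟩
  have hae : ∀ᵐ X ∂μ.map Z, (Xᴴ * X).det ≠ 0 := by
    rw [hZ.map_eq]
    exact (withDensity_absolutelyContinuous _ _).ae_le (CMACG.ae_det_gram_ne_zero hrm)
  filter_upwards [ae_of_ae_map hZ.aemeasurable hae] with ω hω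
  exact ⟨CMACG.rank_eq_of_det_gram_ne_zero hω, CMACG.orientation_mem_stiefel hω⟩
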